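/- Let $\Bbbk$ be a field and $G$ a finite simple graph with vertex set $X$; let $I(G)\subseteq\Bbbk[X]$ be its edge ideal, generated by the monomials $xy$ with $\{x,y\}$ an edge of $G$. For $s\in\mathbb N=\{0,1,2,\dots\}$ put $\mathcal J_s(X)=\{x_j : x\in X,\ 0\le j\le s\}$. For an ideal $I\subseteq\Bbbk[X]$, the ideal of $s$-jets $\mathcal J_s(I)\subseteq\Bbbk[\mathcal J_s(X)]$ is generated by the coefficients of $t^0,\dots,t^s$ in the polynomials obtained from the elements $f\in I$ by the substitution $x\mapsto x_0+x_1t+\dots+x_st^s$. Let $Z\subseteq\operatorname{Spec}\Bbbk[X]$ be the vanishing locus of $I$, with its reduced structure, let $Z_{\mathrm{sing}}$ be the set of points of $Z$ at which the local ring of $Z$ is not regular, let $\mathcal J_s(Z)\subseteq\operatorname{Spec}\Bbbk[\mathcal J_s(X)]$ be the vanishing locus of $\mathcal J_s(\mathbb I(Z))$, where $\mathbb I$ denotes the ideal of functions vanishing on a set, and let $\pi_s\colon\operatorname{Spec}\Bbbk[\mathcal J_s(X)]\to\operatorname{Spec}\Bbbk[X]$ be the projection induced by $x\mapsto x_0$.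 The ideal of principal $s$-jets of $I$ is $$\mathcal P_s(I)=\mathbb I\Bigl(\overline{\mathcal J_s(Z)\setminus\pi_s^{-1}(Z_{\mathrm{sing}})}\Bigr)\subseteq\Bbbk[\mathcal J_s(X)].$$ For every $s\in\mathbb N$ there is exactly one graph $\mathcal P_s(G)$ with vertex set $\mathcal J_s(X)$ whose edge ideal is $\mathcal P_s(I(G))$; its edges are the pairs $\{u,v\}$ of distinct elements of $\mathcal J_s(X)$ with $uv\in\mathcal P_s(I(G))$. It is called the graph of principal $s$-jets of $G$. A graph is chordal if it contains no induced cycle of length four or more, and cochordal if its complement is chordal. Then $G$ is cochordal if and only if $\mathcal P_s(G)$ is cochordal for every $s\in\mathbb N$. -/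

import Mathlib

namespace PrincipalJets

/-- The set `J_s(X)` of jet variables: the pair `(x, j)` stands for the variable `x_j`,
with `0 ≤ j ≤ s`. -/
abbrev JetVars (s : ℕ) (X : Type*) : Type _ := X × Fin (s + 1)

/-- The `k`-algebra homomorphism sending `x` to `x_0 + x_1 t + ... + x_s t^s`. The target is
`k[J_s(X)][t]`; working modulo `t^(s+1)` amounts to reading only the coefficients of
`t^0, ..., t^s`. -/
noncomputable def jetHom (k : Type*) [Field k] (s : ℕ) (X : Type*) :
    MvPolynomial X k →ₐ[k] Polynomial (MvPolynomial (JetVars s X) k) :=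
  MvPolynomial.aeval fun x : X =>
    ∑ j : Fin (s + 1),
      Polynomial.C (MvPolynomial.X (x, j) : MvPolynomial (JetVars s X) k) *
        Polynomial.X ^ (j : ℕ)

/-- The ideal `J_s(I)` of `s`-jets of `I`, generated by the coefficients of `t^0, ..., t^s` in the
images under `jetHom` of the elements of `I`. (As `jetHom` is a ring homomorphism, the elements of
a generating set of `I` give the same ideal.) -/
noncomputable def jetIdeal {k : Type*} [Field k] (s : ℕ) {X : Type*} (I : Ideal (MvPolynomial X k)) :
    Ideal (MvPolynomial (JetVars s X) k) :=
  Ideal.span {g | ∃ f ∈ I, ∃ j : ℕ, j ≤ s ∧ g = (jetHom k s X f).coeff j}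

/-- The projection `π_s` from the jet scheme of affine space to affine space, induced by the
inclusion `x ↦ x_0` of polynomial rings. -/
noncomputable def jetProj (k : Type*) [Field k] (s : ℕ) (X : Type*) :
    PrimeSpectrum (MvPolynomial (JetVars s X) k) → PrimeSpectrum (MvPolynomial X k) :=
  PrimeSpectrum.comap
    (MvPolynomial.rename (fun x : X => ((x, 0) : JetVars s X)) :
      MvPolynomial X k →ₐ[k] MvPolynomial (JetVars s X) k).toRingHom

/-- The singular locus of a closed subset `Z` of `Spec R` with its reduced structure, that is, of
`Spec (R ⧸ 𝕀(Z))`: the points of `Z` at which the local ring is not regular. -/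
def singularLocus {R : Type*} [CommRing R] (Z : Set (PrimeSpectrum R)) :
    Set (PrimeSpectrum R) :=
  PrimeSpectrum.comap (Ideal.Quotient.mk (PrimeSpectrum.vanishingIdeal Z)) ''
    {P | ¬ IsRegularLocalRing (Localization.AtPrime P.asIdeal)}

/-- The jets `J_s(Z)` of a closed subset `Z` of affine space, as a closed subset of the jet scheme
of affine space. -/
noncomputable def jetLocus {k : Type*} [Field k] (s : ℕ) {X : Type*}
    (Z : Set (PrimeSpectrum (MvPolynomial X k))) :
    Set (PrimeSpectrum (MvPolynomial (JetVars s X) k)) :=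
  PrimeSpectrum.zeroLocus (jetIdeal s (PrimeSpectrum.vanishingIdeal Z))

/-- The ideal `P_s(I)` of principal `s`-jets of `I`: with `Z` the vanishing locus of `I`, the ideal
of the Zariski closure of `J_s(Z) ∖ π_s⁻¹(Z_sing)`. -/
noncomputable def principalJetIdeal {k : Type*} [Field k] (s : ℕ) {X : Type*}
    (I : Ideal (MvPolynomial X k)) : Ideal (MvPolynomial (JetVars s X) k) :=
  let Z : Set (PrimeSpectrum (MvPolynomial X k)) := PrimeSpectrum.zeroLocus I
  PrimeSpectrum.vanishingIdeal (closure (jetLocus s Z \ jetProj k s X ⁻¹' singularLocus Z))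

/-- The edge ideal of a graph `G`, generated by the monomials `x y` with `{x, y}` an edge. -/
noncomputable def edgeIdeal (k : Type*) [Field k] {X : Type*} (G : SimpleGraph X) :
    Ideal (MvPolynomial X k) :=
  Ideal.span {m | ∃ x y : X, G.Adj x y ∧ m = MvPolynomial.X x * MvPolynomial.X y}

/-- The graph `P_s(G)` of principal `s`-jets of `G`: the graph on `J_s(X)` whose edges are the pairs
`{u, v}` with `u v ∈ P_s(I(G))`. If some graph on `J_s(X)` has edge ideal `P_s(I(G))`,
it is this one. -/
noncomputable def principalJetGraph (k : Type*) [Field k] (s : ℕ) {X : Type*} (G : SimpleGraph X) :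
    SimpleGraph (JetVars s X) where
  Adj u v := u ≠ v ∧
    MvPolynomial.X u * MvPolynomial.X v ∈ principalJetIdeal s (edgeIdeal k G)
  symm := ⟨fun u v h => ⟨h.1.symm, by rw [mul_comm]; exact h.2⟩⟩
  loopless := ⟨fun _ h => h.1 rfl⟩

/-- A graph is chordal if it has no induced cycle of length four or more. -/
def IsChordal {V : Type*} (G : SimpleGraph V) : Prop :=
  ∀ n : ℕ, 4 ≤ n → IsEmpty (SimpleGraph.cycleGraph n ↪g G)

/-- A graph is cochordal if its complement is chordal. -/
def IsCochordal {V : Type*} (G : SimpleGraph V) : Prop := IsChordal Gᶜ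

end PrincipalJets

/-! `P_s(I(G))` is the edge ideal of the graph obtained from `G` by replacing each vertex with `s +
1` independent copies (`principalJetIdeal_edgeIdeal`). The locus `Z` of `I(G)` is a union of
coordinate subspaces, one for each maximal independent set `M`, on which the variables outside `M`
vanish. A regular local ring is a domain, so for an edge `xy` one of `x`, `y` vanishes on `Z` near
any regular point; all its jets then vanish over that point. Hence every `x_i y_j` is in
`P_s(I(G))`. Conversely, the generic point of the jets of a component lies over the generic point of
that component, which is regular. So `P_s(I(G))` lies in each prime generated by the `x_j` with `x ∉
M`, and those primes cut out the edge ideal. In the complement, copies of one vertex are adjacent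
twins. A cycle of length at least four has no adjacent twins, so induced cycles project injectively
to `Gᶜ`. The converse is the case `s = 0`. -/

namespace PrincipalJets

open MvPolynomial

/-! ### Regular local rings are domains -/

section RegularLocal

open IsLocalRing

/-- A minimal generating family of the maximal ideal can be changed to contain any given element
of `𝔪 ∖ 𝔪²`. -/
theorem exists_erase_span_insert_eq {A : Type*} [CommRing A] [IsLocalRing A] [DecidableEq A]
    {S : Finset A} (hS : Ideal.span (S : Set A) = maximalIdeal A) {x : A}
    (hx : x ∈ maximalIdeal A) (hx2 : x ∉ maximalIdeal A ^ 2) :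
    ∃ a ∈ S, maximalIdeal A ≤ Ideal.span {x} ⊔ Ideal.span (S.erase a : Set A) := by
  have hxS : x ∈ Submodule.span A (S : Set A) := by
    rw [← hS] at hx
    exact hx
  obtain ⟨c, -, hc⟩ := Submodule.mem_span_finset.mp hxS
  have hmem : ∀ b ∈ S, b ∈ maximalIdeal A := fun b hb => hS ▸ Ideal.subset_span hb
  obtain ⟨a, ha, hca⟩ : ∃ a ∈ S, IsUnit (c a) := by
    by_contra! h
    refine hx2 (hc ▸ Ideal.sum_mem _ fun b hb => ?_)
    rw [pow_two, smul_eq_mul]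
    exact Ideal.mul_mem_mul ((mem_maximalIdeal _).mpr (h b hb)) (hmem b hb)
  refine ⟨a, ha, ?_⟩
  have key : a ∈ Ideal.span {x} ⊔ Ideal.span (S.erase a : Set A) := by
    obtain ⟨u, hu⟩ := hca
    rw [← Finset.add_sum_erase _ _ ha, ← hu] at hc
    simp only [smul_eq_mul] at hc
    have h : (↑u⁻¹ : A) * (x - ∑ b ∈ S.erase a, c b * b) = a := by
      rw [sub_eq_of_eq_add hc.symm, Units.inv_mul_cancel_left]
    have hmem' := Ideal.mul_mem_left _ (↑u⁻¹ : A) (Ideal.sub_mem _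
      (Ideal.mem_sup_left (Ideal.mem_span_singleton_self x))
      (Ideal.mem_sup_right (T := Ideal.span (S.erase a : Set A)) (Ideal.sum_mem _ fun b hb =>
        Ideal.mul_mem_left _ (c b) (Ideal.subset_span hb))))
    rwa [h] at hmem'
  rw [← hS, Ideal.span_le]
  intro b hb
  by_cases hab : b = a
  · exact hab ▸ key
  · exact Ideal.mem_sup_right (Ideal.subset_span (Finset.mem_erase.mpr ⟨hab, hb⟩))

/-- A Noetherian local ring of dimension at least `n` whose maximal ideal is generated by `n`
elements is a domain. -/
theorem isDomain_of_span_eq_maximalIdeal (n : ℕ) :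
    ∀ (A : Type*) [CommRing A] [IsLocalRing A] [IsNoetherianRing A] (S : Finset A),
      S.card ≤ n → Ideal.span (S : Set A) = maximalIdeal A → (n : WithBot ℕ∞) ≤ ringKrullDim A →
      IsDomain A := by
  classical
  induction n with
  | zero =>
    intro A _ _ _ S hn hS _
    obtain rfl : S = ∅ := by simpa using hn
    have h : maximalIdeal A = ⊥ := by simpa using hS.symm
    exact (isField_iff_maximalIdeal_eq.mpr h).isDomain
  | succ n ih =>
    intro A _ _ _ S hn hS hdim
    have hmin : ∀ p ∈ minimalPrimes A, ¬ maximalIdeal A ≤ p := by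
      intro p hp hle
      have hpp : p.IsPrime := hp.1.1
      have hpm : p = maximalIdeal A := le_antisymm (le_maximalIdeal hpp.ne_top) hle
      have h0 : (maximalIdeal A).height = 0 := Ideal.height_eq_zero_iff.mpr (hpm ▸ hp)
      rw [← maximalIdeal_height_eq_ringKrullDim, h0] at hdim
      norm_cast at hdim
    obtain ⟨p₀, hp₀, -⟩ := Ideal.exists_minimalPrimes_le (bot_le : ⊥ ≤ maximalIdeal A)
    have hsq : ¬ maximalIdeal A ≤ maximalIdeal A ^ 2 := by
      intro h
      rw [pow_two] at h
      have hbot := Submodule.eq_bot_of_le_smul_of_le_jacobson_bot (maximalIdeal A) (maximalIdeal A)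
        (IsNoetherian.noetherian _) h (maximalIdeal_le_jacobson _)
      exact hmin p₀ hp₀ (hbot ▸ bot_le)
    obtain ⟨x, hx, hxn⟩ : ∃ x ∈ maximalIdeal A,
        x ∉ ⋃ i ∈ insert (maximalIdeal A ^ 2) (minimalPrimes A), ((id i : Ideal A) : Set A) := by
      by_contra! h
      -- Prime avoidance tolerates two ideals that need not be prime; `𝔪²` fills both slots.
      obtain ⟨p, hp, hle⟩ := (Ideal.subset_union_prime_finite
        ((minimalPrimes.finite_of_isNoetherianRing A).insert (maximalIdeal A ^ 2))
        (maximalIdeal A ^ 2) (maximalIdeal A ^ 2) (fun i hi hne _ =>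
          ((Set.mem_insert_iff.mp hi).resolve_left hne).1.1)).mp h
      rcases hp with rfl | hp
      · exact hsq hle
      · exact hmin p hp hle
    simp only [Set.mem_iUnion, not_exists, id] at hxn
    have hx2 : x ∉ maximalIdeal A ^ 2 := hxn _ (Set.mem_insert _ _)
    have hxp : ∀ p ∈ minimalPrimes A, x ∉ p := fun p hp => hxn p (Set.mem_insert_of_mem _ hp)
    obtain ⟨a, ha, hle⟩ := exists_erase_span_insert_eq hS hx hx2
    have hne : Ideal.span {x} ≠ ⊤ := fun h =>
      (maximalIdeal.isMaximal A).ne_top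
        (top_le_iff.mp (h ▸ (Ideal.span_singleton_le_iff_mem _).mpr hx))
    have : Nontrivial (A ⧸ Ideal.span {x}) := Ideal.Quotient.nontrivial_iff.mpr hne
    have hloc : IsLocalRing (A ⧸ Ideal.span {x}) :=
      IsLocalRing.of_surjective' (Ideal.Quotient.mk _) Ideal.Quotient.mk_surjective
    have hmap : (maximalIdeal A).map (Ideal.Quotient.mk (Ideal.span {x})) =
        maximalIdeal (A ⧸ Ideal.span {x}) := by
      have hc := ((local_hom_TFAE (Ideal.Quotient.mk (Ideal.span {x}))).out 0 4).mp
        (IsLocalHom.of_surjective _ Ideal.Quotient.mk_surjective)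
      rw [← hc, Ideal.map_comap_of_surjective _ Ideal.Quotient.mk_surjective]
    have hdom : IsDomain (A ⧸ Ideal.span {x}) := by
      refine ih _ ((S.erase a).image (Ideal.Quotient.mk _)) ?_ ?_ ?_
      · refine Finset.card_image_le.trans ?_
        rw [Finset.card_erase_of_mem ha]
        lia
      · rw [Finset.coe_image, ← Ideal.map_span, ← hmap]
        refine le_antisymm (Ideal.map_mono ?_) ((Ideal.map_mono hle).trans ?_)
        · rw [← hS]
          exact Ideal.span_mono (Finset.coe_subset.mpr (Finset.erase_subset _ _))
        · rw [Ideal.map_sup, Ideal.map_quotient_self, bot_sup_eq]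
      · have h1 := ringKrullDim_le_ringKrullDim_quotient_add_card ({x} : Finset A)
          (by simpa [Ring.jacobson_eq_sInf_isMaximal, Ideal.jacobson] using
            maximalIdeal_le_jacobson (⊥ : Ideal A) hx)
        rw [Finset.coe_singleton] at h1
        simp only [Finset.card_singleton, Nat.cast_one] at h1
        have h2 := hdim.trans h1
        rw [Nat.cast_add, Nat.cast_one] at h2
        exact (ENat.WithBot.add_le_add_one_right_iff).mp h2
    have hprime : (Ideal.span {x}).IsPrime := (Ideal.Quotient.isDomain_iff_prime _).mp hdom
    obtain ⟨p, hp, hpx⟩ := Ideal.exists_minimalPrimes_le (bot_le : ⊥ ≤ Ideal.span {x})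
    have hpp : p.IsPrime := hp.1.1
    -- Each element of `p` is `z * x`, and `x ∉ p` puts `z` in `p`. So `p ≤ 𝔪 p`, and Nakayama
    -- applies.
    have hbot : p = ⊥ := by
      refine Submodule.eq_bot_of_le_smul_of_le_jacobson_bot (maximalIdeal A) p
        (IsNoetherian.noetherian _) (fun y hy => ?_) (maximalIdeal_le_jacobson _)
      obtain ⟨z, rfl⟩ := Ideal.mem_span_singleton'.mp (hpx hy)
      rw [mul_comm]
      exact Ideal.mul_mem_mul hx ((hpp.mem_or_mem hy).resolve_right (hxp p hp))
    exact IsDomain.of_bot_isPrime A (hbp := hbot ▸ hpp)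

theorem isDomain_of_isRegularLocalRing (A : Type*) [CommRing A] [IsRegularLocalRing A] :
    IsDomain A := by
  obtain ⟨S, hcard, hS⟩ := Submodule.FG.exists_span_finset_card_eq_spanFinrank
    (IsNoetherian.noetherian (maximalIdeal A))
  exact isDomain_of_span_eq_maximalIdeal _ A S hcard.le hS
    (IsRegularLocalRing.spanFinrank_maximalIdeal (R := A)).le

theorem isRegularLocalRing_of_maximalIdeal_eq_bot {A : Type*} [CommRing A] [IsLocalRing A]
    [IsNoetherianRing A] (h : maximalIdeal A = ⊥) : IsRegularLocalRing A := by
  rw [isRegularLocalRing_iff, h, Submodule.spanFinrank_bot,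
    ringKrullDim_eq_zero_of_isField (isField_iff_maximalIdeal_eq.mpr h), Nat.cast_zero]

end RegularLocal

/-! ### Induced cycles, twins and independent sets -/

section Combinatorics

open scoped Fin.CommRing

/-- Of two adjacent vertices of a cycle of length at least four, the first has a neighbour which
is not a neighbour of the second. -/
theorem exists_adj_not_adj_cycleGraph {n : ℕ} (hn : 4 ≤ n) {u v : Fin n}
    (huv : (SimpleGraph.cycleGraph n).Adj u v) :
    ∃ w, w ≠ v ∧ (SimpleGraph.cycleGraph n).Adj u w ∧ ¬ (SimpleGraph.cycleGraph n).Adj v w := by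
  obtain ⟨n, rfl⟩ := Nat.exists_eq_add_of_le' hn
  have h1 : (1 : Fin (n + 4)) ≠ 0 := by simp
  have h2 : (2 : Fin (n + 4)) ≠ 0 := by simp [Fin.ext_iff, Nat.mod_eq_of_lt]
  have h3 : (3 : Fin (n + 4)) ≠ 0 := by simp [Fin.ext_iff, Nat.mod_eq_of_lt]
  simp only [SimpleGraph.cycleGraph_adj, not_or] at huv ⊢
  -- The witness is the neighbour of `u` on the side away from `v`; it is two steps from `v`.
  rcases huv with h | h
  · exact ⟨v + 2, fun e => h2 (by linear_combination e),
      Or.inr (by linear_combination -h),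
      fun e => h3 (by linear_combination -e), fun e => h1 (by linear_combination e)⟩
  · exact ⟨u - 1, fun e => h2 (by linear_combination -e + -h), Or.inl (by ring),
      fun e => h1 (by linear_combination e - h), fun e => h3 (by linear_combination -e - h)⟩

/-- Two vertices of an induced cycle over the same `x` would be adjacent twins, which
`exists_adj_not_adj_cycleGraph` excludes. -/
theorem isCochordal_comap_fst {X Y : Type*} {G : SimpleGraph X} (hG : IsCochordal G) :
    IsCochordal (G.comap (Prod.fst : X × Y → X)) := by
  refine fun n hn => ⟨fun φ => (hG n hn).false ?_⟩
  have hφ : ∀ u v, u ≠ v →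
      ((SimpleGraph.cycleGraph n).Adj u v ↔ ¬ G.Adj (φ u).1 (φ v).1) := by
    intro u v huv
    rw [← φ.map_adj_iff, SimpleGraph.compl_adj, SimpleGraph.comap_adj,
      and_iff_right (φ.injective.ne huv)]
  have hinj : Function.Injective fun u => (φ u).1 := by
    intro u v huv
    by_contra hne
    dsimp only at huv
    obtain ⟨w, hwv, hu, hv⟩ := exists_adj_not_adj_cycleGraph hn
      ((hφ u v hne).mpr (by rw [huv]; exact G.irrefl))
    rw [hφ u w hu.ne, huv] at hu
    exact hv ((hφ v w hwv.symm).mpr hu)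
  refine ⟨⟨fun u => (φ u).1, hinj⟩, fun {u v} => ?_⟩
  rw [SimpleGraph.compl_adj]
  constructor
  · rintro ⟨hne, h⟩
    exact (hφ u v fun h => hne (by rw [h])).mpr h
  · intro h
    exact ⟨hinj.ne h.ne, (hφ u v h.ne).mp h⟩

theorem isCochordal_of_comap {X Y : Type*} {G : SimpleGraph X} {f : Y → X}
    (hf : f.Bijective) (h : IsCochordal (G.comap f)) : IsCochordal G := by
  refine fun n hn => ⟨fun φ => (h n hn).false ?_⟩
  let e := Equiv.ofBijective f hf
  refine φ.trans ⟨e.symm.toEmbedding, fun {u v} => ?_⟩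
  have hs : ∀ u, f (e.symm u) = u := e.apply_symm_apply
  simp [SimpleGraph.compl_adj, hs]

/-- Every independent set is contained in a maximal one. -/
theorem exists_maximal_isIndepSet {X : Type*} [Finite X] (G : SimpleGraph X) {s : Set X}
    (hs : G.IsIndepSet s) :
    ∃ M, s ⊆ M ∧ G.IsIndepSet M ∧ ∀ x ∉ M, ∃ y ∈ M, G.Adj x y := by
  obtain ⟨M, hsM, hM⟩ := Finite.exists_le_maximal (p := fun t => G.IsIndepSet t) hs
  refine ⟨M, hsM, hM.prop, fun x hx => ?_⟩
  by_contra! h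
  refine hx (hM.le_of_ge (y := insert x M) ?_ (Set.subset_insert x M) (Set.mem_insert x M))
  exact hM.prop.insert fun y hy _ => ⟨h y hy, fun h' => h y hy h'.symm⟩

end Combinatorics

/-! ### Edge ideals and coordinate primes -/

section EdgeIdeal

variable {k : Type*} [Field k] {V : Type*}

/-- Membership in a monomial ideal is tested on monomials, and the ends of an edge are distinct, so
only supports matter. -/
theorem mem_edgeIdeal_iff {G : SimpleGraph V} {f : MvPolynomial V k} :
    f ∈ edgeIdeal k G ↔ ∀ m ∈ f.support, ∃ x y, G.Adj x y ∧ m x ≠ 0 ∧ m y ≠ 0 := by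
  classical
  have h : edgeIdeal k G = Ideal.span ((fun e => monomial e (1 : k)) ''
      {e | ∃ x y, G.Adj x y ∧ e = Finsupp.single x 1 + Finsupp.single y 1}) := by
    unfold edgeIdeal
    congr 1
    ext m
    constructor
    · rintro ⟨x, y, hxy, rfl⟩
      exact ⟨_, ⟨x, y, hxy, rfl⟩, by simp [X, monomial_mul]⟩
    · rintro ⟨_, ⟨x, y, hxy, rfl⟩, rfl⟩
      exact ⟨x, y, hxy, by simp [X, monomial_mul]⟩
  rw [h, mem_ideal_span_monomial_image]
  refine forall₂_congr fun m _ => ?_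
  constructor
  · rintro ⟨_, ⟨x, y, hxy, rfl⟩, hle⟩
    have hx := hle x
    have hy := hle y
    simp only [Finsupp.add_apply, Finsupp.single_eq_same] at hx hy
    exact ⟨x, y, hxy, by lia, by lia⟩
  · rintro ⟨x, y, hxy, hx, hy⟩
    refine ⟨_, ⟨x, y, hxy, rfl⟩, fun z => ?_⟩
    have := hxy.ne
    simp only [Finsupp.add_apply, Finsupp.single_apply]
    split_ifs <;> grind

theorem X_mul_X_mem_edgeIdeal_iff {G : SimpleGraph V} {u v : V} (huv : u ≠ v) :
    (X u * X v : MvPolynomial V k) ∈ edgeIdeal k G ↔ G.Adj u v := by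
  classical
  refine ⟨fun h => ?_, fun h => Ideal.subset_span ⟨u, v, h, rfl⟩⟩
  have hm : (X u * X v : MvPolynomial V k) =
      monomial (Finsupp.single u 1 + Finsupp.single v 1) 1 := by
    simp [X, monomial_mul]
  obtain ⟨x, y, hxy, hx, hy⟩ := mem_edgeIdeal_iff.mp h (Finsupp.single u 1 + Finsupp.single v 1)
    (by simp [hm])
  have := hxy.ne
  have := hxy.symm
  simp only [Finsupp.add_apply, Finsupp.single_apply] at hx hy
  grind

theorem edgeIdeal_injective : Function.Injective (edgeIdeal k : SimpleGraph V → _) := by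
  intro G H h
  ext u v
  by_cases huv : u = v
  · subst huv
    simp
  · rw [← X_mul_X_mem_edgeIdeal_iff (k := k) huv, h, X_mul_X_mem_edgeIdeal_iff huv]

/-- A polynomial killed by setting the variables of `s` to zero is in the ideal they generate. -/
theorem mem_span_X_image_of_aeval_eq_zero {s : Set V} [DecidablePred (· ∈ s)]
    {f : MvPolynomial V k}
    (hf : aeval (fun x => if x ∈ s then 0 else (X x : MvPolynomial V k)) f = 0) :
    f ∈ Ideal.span (X '' s : Set (MvPolynomial V k)) := by
  have h : (Ideal.Quotient.mkₐ k (Ideal.span (X '' s : Set (MvPolynomial V k)))).comp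
      (aeval fun x => if x ∈ s then 0 else (X x : MvPolynomial V k)) =
      Ideal.Quotient.mkₐ k (Ideal.span (X '' s : Set (MvPolynomial V k))) := by
    ext x
    by_cases hx : x ∈ s
    · simp only [AlgHom.comp_apply, aeval_X, if_pos hx, map_zero]
      exact (Ideal.Quotient.eq_zero_iff_mem.mpr
        (Ideal.subset_span (Set.mem_image_of_mem _ hx))).symm
    · simp [hx]
  rw [← Ideal.Quotient.eq_zero_iff_mem, ← Ideal.Quotient.mkₐ_eq_mk k, ← h, AlgHom.comp_apply, hf,
    map_zero]

theorem isPrime_span_X_image (s : Set V) :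
    (Ideal.span (X '' s : Set (MvPolynomial V k))).IsPrime := by
  classical
  let φ : MvPolynomial V k →ₐ[k] MvPolynomial V k :=
    aeval fun x => if x ∈ s then 0 else X x
  have h : Ideal.span (X '' s : Set (MvPolynomial V k)) = RingHom.ker φ := by
    refine le_antisymm (Ideal.span_le.mpr ?_) fun f hf => mem_span_X_image_of_aeval_eq_zero hf
    rintro _ ⟨x, hx, rfl⟩
    simp [φ, hx]
  rw [h]
  exact RingHom.ker_isPrime _

theorem X_mem_span_X_image_iff {s : Set V} {x : V} :
    (X x : MvPolynomial V k) ∈ Ideal.span (X '' s : Set (MvPolynomial V k)) ↔ x ∈ s := by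
  classical
  rw [mem_ideal_span_X_image, support_X]
  simp [Finsupp.single_apply]

theorem monomial_mem_of_X_mem {P : Ideal (MvPolynomial V k)} {m : V →₀ ℕ}
    {c : k} {x : V} (hm : m x ≠ 0) (h : X x ∈ P) : monomial m c ∈ P := by
  refine P.mem_of_dvd ?_ h
  rw [X_dvd_monomial]
  exact Or.inr hm

end EdgeIdeal

/-! ### Regular points of the zero locus -/

section SmoothPoints

/-- At a point of `Z` outside the singular locus, `Z` is locally irreducible. -/
theorem exists_notMem_mul_mem_of_notMem_singularLocus {R : Type*} [CommRing R]
    {Z : Set (PrimeSpectrum R)} {P : PrimeSpectrum R}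
    (hP : PrimeSpectrum.vanishingIdeal Z ≤ P.asIdeal) (hZ : P ∉ singularLocus Z) {a b : R}
    (hab : a * b ∈ PrimeSpectrum.vanishingIdeal Z) :
    (∃ f ∉ P.asIdeal, f * a ∈ PrimeSpectrum.vanishingIdeal Z) ∨
      ∃ f ∉ P.asIdeal, f * b ∈ PrimeSpectrum.vanishingIdeal Z := by
  obtain ⟨P', rfl⟩ : P ∈ Set.range
      (PrimeSpectrum.comap (Ideal.Quotient.mk (PrimeSpectrum.vanishingIdeal Z))) := by
    rw [range_comap_of_surjective _ _ Ideal.Quotient.mk_surjective,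
      Ideal.mk_ker]
    exact hP
  have hreg : IsRegularLocalRing (Localization.AtPrime P'.asIdeal) := by
    by_contra h
    exact hZ ⟨P', h, rfl⟩
  have hdom := isDomain_of_isRegularLocalRing (Localization.AtPrime P'.asIdeal)
  have key : ∀ c : R, algebraMap _ (Localization.AtPrime P'.asIdeal)
      (Ideal.Quotient.mk (PrimeSpectrum.vanishingIdeal Z) c) = 0 →
      ∃ f ∉ (PrimeSpectrum.comap (Ideal.Quotient.mk _) P').asIdeal,
        f * c ∈ PrimeSpectrum.vanishingIdeal Z := by
    intro c hc
    obtain ⟨⟨m, hm⟩, h⟩ := (IsLocalization.map_eq_zero_iff P'.asIdeal.primeCompl _ _).mp hc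
    obtain ⟨f, rfl⟩ := Ideal.Quotient.mk_surjective m
    exact ⟨f, hm, Ideal.Quotient.eq_zero_iff_mem.mp (by rw [map_mul]; exact h)⟩
  have h0 : algebraMap _ (Localization.AtPrime P'.asIdeal)
      (Ideal.Quotient.mk (PrimeSpectrum.vanishingIdeal Z) (a * b)) = 0 := by
    rw [Ideal.Quotient.eq_zero_iff_mem.mpr hab, map_zero]
  rw [map_mul, map_mul, mul_eq_zero] at h0
  exact h0.imp (key a) (key b)

/-- If generators of the prime `P` vanish on `Z` in a neighbourhood of `P`, then the local ring of
`Z` at `P` is a field, and so `P` is a regular point. -/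
theorem notMem_singularLocus_of_forall_mul_mem {R : Type*} [CommRing R] [IsNoetherianRing R]
    {Z : Set (PrimeSpectrum R)} {P : PrimeSpectrum R} {S : Set R} (hS : P.asIdeal = Ideal.span S)
    (h : ∀ a ∈ S, ∃ f ∉ P.asIdeal, f * a ∈ PrimeSpectrum.vanishingIdeal Z) :
    P ∉ singularLocus Z := by
  rintro ⟨P', hP', rfl⟩
  refine hP' (isRegularLocalRing_of_maximalIdeal_eq_bot ?_)
  rw [← Localization.AtPrime.map_eq_maximalIdeal, eq_bot_iff, Ideal.map_le_iff_le_comap]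
  intro a ha
  obtain ⟨a, rfl⟩ := Ideal.Quotient.mk_surjective a
  have hle : Ideal.span S ≤ RingHom.ker ((algebraMap _ (Localization.AtPrime P'.asIdeal)).comp
      (Ideal.Quotient.mk (PrimeSpectrum.vanishingIdeal Z))) := by
    rw [Ideal.span_le]
    intro b hb
    obtain ⟨f, hf, hfb⟩ := h b hb
    refine (IsLocalization.map_eq_zero_iff P'.asIdeal.primeCompl _ _).mpr
      ⟨⟨Ideal.Quotient.mk _ f, hf⟩, ?_⟩
    rw [← map_mul]
    exact Ideal.Quotient.eq_zero_iff_mem.mpr hfb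
  exact hle (hS ▸ (show a ∈ (PrimeSpectrum.comap (Ideal.Quotient.mk _) P').asIdeal from ha))

variable {k : Type*} [Field k] {V : Type*}

/-- A vertex variable vanishing on the zero locus of an edge ideal near `P` has a neighbour which
is invertible at `P`. -/
theorem exists_adj_X_notMem {G : SimpleGraph V} {P : Ideal (MvPolynomial V k)} [hP : P.IsPrime]
    (hle : edgeIdeal k G ≤ P) {x : V} {f : MvPolynomial V k} (hf : f ∉ P)
    (hfx : f * X x ∈ (edgeIdeal k G).radical) : ∃ v, G.Adj x v ∧ X v ∉ P := by
  classical
  obtain ⟨n, hn⟩ := hfx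
  rw [mul_pow] at hn
  have hfn : f ^ n ∉ P := fun h => hf (hP.mem_of_pow_mem n h)
  -- All variables of such an `m` are invertible at `P`. The monomial `m * x ^ n` contains an edge,
  -- which cannot lie inside `m` as edges vanish at `P`; so it joins `x` to a variable of `m`.
  obtain ⟨m, hm, hmP⟩ : ∃ m ∈ (f ^ n).support, monomial m (coeff m (f ^ n)) ∉ P := by
    by_contra! h
    refine hfn ?_
    rw [(f ^ n).as_sum]
    exact P.sum_mem h
  have hsupp : m + Finsupp.single x n ∈ (f ^ n * X x ^ n).support := by
    rw [mem_support_iff, X_pow_eq_monomial, coeff_mul_monomial, mul_one]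
    exact mem_support_iff.mp hm
  have hvar : ∀ v, m v ≠ 0 → X v ∉ P := fun v hv h => hmP (monomial_mem_of_X_mem hv h)
  obtain ⟨u, v, huv, hu, hv⟩ := mem_edgeIdeal_iff.mp hn _ hsupp
  simp only [Finsupp.add_apply, Finsupp.single_apply] at hu hv
  by_cases hxu : x = u
  · subst hxu
    rw [if_neg huv.ne, add_zero] at hv
    exact ⟨v, huv, hvar v hv⟩
  · rw [if_neg hxu, add_zero] at hu
    by_cases hxv : x = v
    · subst hxv
      exact ⟨u, huv.symm, hvar u hu⟩
    · rw [if_neg hxv, add_zero] at hv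
      rcases hP.mem_or_mem (hle (Ideal.subset_span ⟨u, v, huv, rfl⟩)) with h | h
      · exact absurd h (hvar u hu)
      · exact absurd h (hvar v hv)

end SmoothPoints

/-! ### Jets of coordinate subspaces -/

section Jets

variable {k : Type*} [Field k] {V : Type*} {s : ℕ}

theorem coeff_jetHom_X (x : V) (j : Fin (s + 1)) :
    (jetHom k s V (X x)).coeff j = X (x, j) := by
  simp [jetHom, Polynomial.coeff_C_mul, Polynomial.coeff_X_pow,
    Fin.val_inj]

/-- Over a point where `y` is invertible, the jets of `x y = 0` are the jets of `x = 0`. -/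
theorem X_mem_of_X_mul_X_mem {Q : Ideal (MvPolynomial (JetVars s V) k)} [hQ : Q.IsPrime]
    {I : Ideal (MvPolynomial V k)} (hI : jetIdeal s I ≤ Q) {x y : V} (hxy : X x * X y ∈ I)
    (hy : X (y, 0) ∉ Q) (j : Fin (s + 1)) : X (x, j) ∈ Q := by
  obtain ⟨j, hj⟩ := j
  induction j using Nat.strong_induction_on with
  | _ j ih =>
    have h : (jetHom k s V (X x * X y)).coeff j ∈ Q :=
      hI (Ideal.subset_span ⟨_, hxy, j, by lia, rfl⟩)
    -- Isolate `x_j y_0` in the coefficient of `t ^ j`; every other term has a factor `x_i` with `i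
    -- < j`, in `Q` by induction.
    rw [map_mul, Polynomial.coeff_mul, ← Finset.add_sum_erase _ _
      (show (j, 0) ∈ Finset.HasAntidiagonal.antidiagonal j by simp)] at h
    have h0 := (Q.add_mem_iff_left (Q.sum_mem fun p hp => ?_)).mp h
    · have hx := coeff_jetHom_X (k := k) (s := s) x ⟨j, hj⟩
      have hy' := coeff_jetHom_X (k := k) (s := s) y 0
      simp only [Fin.val_zero] at hx hy'
      rw [hx, hy'] at h0
      exact (hQ.mem_or_mem h0).resolve_right hy
    · obtain ⟨hne, hp⟩ := Finset.mem_erase.mp hp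
      rw [Finset.HasAntidiagonal.mem_antidiagonal] at hp
      have hlt : p.1 < j := by
        by_contra hge
        exact hne (Prod.ext (by lia) (by lia))
      have hx := coeff_jetHom_X (k := k) (s := s) x ⟨p.1, by lia⟩
      dsimp only at hx
      rw [hx]
      exact Q.mul_mem_right _ (ih p.1 hlt _)

/-- The jets of the coordinates generate an ideal containing the jet ideal of a coordinate
subspace. -/
theorem jetIdeal_le_span_X_image {I : Ideal (MvPolynomial V k)} {C : Set V}
    (hI : I ≤ Ideal.span (X '' C)) :
    jetIdeal s I ≤ Ideal.span (X '' (Prod.fst ⁻¹' C : Set (JetVars s V))) := by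
  refine Ideal.span_le.mpr ?_
  rintro _ ⟨f, hf, j, -, rfl⟩
  -- The extension along `Polynomial.C` consists of the polynomials with all coefficients in the
  -- ideal, so checking the generators suffices.
  have h : Ideal.span (X '' C) ≤
      (Ideal.map Polynomial.C (Ideal.span (X '' (Prod.fst ⁻¹' C : Set (JetVars s V))))).comap
        (jetHom k s V) := by
    refine Ideal.span_le.mpr ?_
    rintro _ ⟨x, hx, rfl⟩
    simp only [jetHom, SetLike.mem_coe, Ideal.mem_comap, aeval_X]
    refine Ideal.sum_mem _ fun j _ => Ideal.mul_mem_right _ _ (Ideal.mem_map_of_mem _ ?_)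
    exact Ideal.subset_span ⟨(x, j), hx, rfl⟩
  exact Ideal.mem_map_C_iff.mp (h (hI hf)) j

/-- Places the generic point of the jets of a coordinate subspace over the generic point of that
subspace. -/
theorem comap_rename_span_X_image (C : Set V) :
    (Ideal.span (X '' (Prod.fst ⁻¹' C : Set (JetVars s V)))).comap
      (rename fun x : V => ((x, 0) : JetVars s V) : MvPolynomial V k →ₐ[k] _) =
      Ideal.span (X '' C) := by
  classical
  refine le_antisymm (fun f hf => ?_) (Ideal.span_le.mpr ?_)
  · have hinj : Function.Injective fun x : V => ((x, 0) : JetVars s V) :=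
      fun x y h => (Prod.ext_iff.mp h).1
    rw [Ideal.mem_comap, mem_ideal_span_X_image] at hf
    rw [mem_ideal_span_X_image]
    intro m hm
    obtain ⟨u, hu, hmu⟩ := hf (m.mapDomain fun x : V => ((x, 0) : JetVars s V)) (by
      rw [mem_support_iff]
      erw [coeff_rename_mapDomain _ hinj]
      exact mem_support_iff.mp hm)
    obtain ⟨x, hx, rfl⟩ := Finset.mem_image.mp
      (Finsupp.mapDomain_support (Finsupp.mem_support_iff.mpr hmu))
    exact ⟨x, hu, Finsupp.mem_support_iff.mp hx⟩
  · rintro _ ⟨x, hx, rfl⟩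
    simp only [SetLike.mem_coe, Ideal.mem_comap, rename_X]
    exact Ideal.subset_span ⟨(x, 0), hx, rfl⟩

end Jets

/-! ### Principal jets of edge ideals -/

section Principal

variable {k : Type*} [Field k] {V : Type*}

theorem edgeIdeal_comap_fst_le (s : ℕ) (G : SimpleGraph V) :
    edgeIdeal k (G.comap (Prod.fst : JetVars s V → V)) ≤
      principalJetIdeal s (edgeIdeal k G) := by
  unfold principalJetIdeal
  rw [PrimeSpectrum.vanishingIdeal_closure]
  refine Ideal.span_le.mpr ?_
  rintro _ ⟨⟨x, i⟩, ⟨y, j⟩, hxy, rfl⟩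
  change G.Adj x y at hxy
  simp only [SetLike.mem_coe, PrimeSpectrum.mem_vanishingIdeal]
  rintro Q ⟨hQ, hsing⟩
  replace hQ : jetIdeal s (PrimeSpectrum.vanishingIdeal (PrimeSpectrum.zeroLocus
    (edgeIdeal k G : Set (MvPolynomial V k)))) ≤ Q.asIdeal := hQ
  set Z := PrimeSpectrum.zeroLocus (edgeIdeal k G : Set (MvPolynomial V k)) with hZ
  have hrad : PrimeSpectrum.vanishingIdeal Z = (edgeIdeal k G).radical :=
    PrimeSpectrum.vanishingIdeal_zeroLocus_eq_radical _
  have hIZ : edgeIdeal k G ≤ PrimeSpectrum.vanishingIdeal Z := hrad ▸ Ideal.le_radical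
  have hX : ∀ v, X v ∈ (jetProj k s V Q).asIdeal ↔ X (v, 0) ∈ Q.asIdeal := by
    intro v
    change (rename _ (X v)) ∈ Q.asIdeal ↔ _
    rw [rename_X]
  have hle : PrimeSpectrum.vanishingIdeal Z ≤ (jetProj k s V Q).asIdeal := by
    rw [hrad, (jetProj k s V Q).isPrime.radical_le_iff]
    refine Ideal.span_le.mpr ?_
    rintro _ ⟨u, v, huv, rfl⟩
    by_cases hv : X (v, 0) ∈ Q.asIdeal
    · exact Ideal.mul_mem_left _ _ ((hX v).mpr hv)
    · exact Ideal.mul_mem_right _ _ ((hX u).mpr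
        (X_mem_of_X_mul_X_mem hQ (hIZ (Ideal.subset_span ⟨u, v, huv, rfl⟩)) hv 0))
  -- If `v` vanishes on `Z` near the image of `Q`, some neighbour `w` is invertible there, and the
  -- jet equations of `v w` kill every jet of `v`.
  have key : ∀ (v : V) (j : Fin (s + 1)),
      (∃ f ∉ (jetProj k s V Q).asIdeal, f * X v ∈ PrimeSpectrum.vanishingIdeal Z) →
      X (v, j) ∈ Q.asIdeal := by
    rintro v j ⟨f, hf, hfv⟩
    obtain ⟨w, hvw, hw⟩ := exists_adj_X_notMem (hIZ.trans hle) hf (hrad ▸ hfv)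
    exact X_mem_of_X_mul_X_mem hQ (hIZ (Ideal.subset_span ⟨v, w, hvw, rfl⟩))
      (fun h => hw ((hX w).mpr h)) j
  rcases exists_notMem_mul_mem_of_notMem_singularLocus hle hsing
    (hIZ (Ideal.subset_span ⟨x, y, hxy, rfl⟩)) with h | h
  · exact Ideal.mul_mem_right _ _ (key x i h)
  · exact Ideal.mul_mem_left _ _ (key y j h)

/-- The principal jets vanish on the jets of each irreducible component. -/
theorem principalJetIdeal_le_span_X_image [Finite V] (s : ℕ) {G : SimpleGraph V} {M : Set V}
    (hM : G.IsIndepSet M) (hmax : ∀ x ∉ M, ∃ y ∈ M, G.Adj x y) :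
    principalJetIdeal s (edgeIdeal k G) ≤
      Ideal.span (X '' (Prod.fst ⁻¹' Mᶜ : Set (JetVars s V))) := by
  let Q : PrimeSpectrum (MvPolynomial (JetVars s V) k) :=
    ⟨_, isPrime_span_X_image (Prod.fst ⁻¹' Mᶜ)⟩
  unfold principalJetIdeal
  rw [PrimeSpectrum.vanishingIdeal_closure]
  intro f hf
  refine (PrimeSpectrum.mem_vanishingIdeal _ _).mp hf Q ?_
  have hrad : PrimeSpectrum.vanishingIdeal (PrimeSpectrum.zeroLocus
      (edgeIdeal k G : Set (MvPolynomial V k))) = (edgeIdeal k G).radical :=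
    PrimeSpectrum.vanishingIdeal_zeroLocus_eq_radical _
  have hproj : (jetProj k s V Q).asIdeal = Ideal.span (X '' Mᶜ) := comap_rename_span_X_image Mᶜ
  refine ⟨?_, notMem_singularLocus_of_forall_mul_mem hproj ?_⟩
  · refine jetIdeal_le_span_X_image ?_
    rw [hrad, (isPrime_span_X_image Mᶜ).radical_le_iff]
    refine Ideal.span_le.mpr ?_
    rintro _ ⟨x, y, hxy, rfl⟩
    by_cases hx : x ∈ M
    · exact Ideal.mul_mem_left _ _ (Ideal.subset_span
        ⟨y, fun hy => hM hx hy hxy.ne hxy, rfl⟩)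
    · exact Ideal.mul_mem_right _ _ (Ideal.subset_span ⟨x, hx, rfl⟩)
  · rintro _ ⟨x, hx, rfl⟩
    -- Maximality of `M` gives regularity: `y` is invertible at the generic point of the component
    -- and `y x = 0` on `Z`.
    obtain ⟨y, hy, hxy⟩ := hmax x hx
    refine ⟨X y, ?_, ?_⟩
    · rw [hproj, X_mem_span_X_image_iff]
      exact fun h => h hy
    · rw [hrad]
      exact Ideal.le_radical (Ideal.subset_span ⟨y, x, hxy.symm, rfl⟩)

/-- The ideal of principal jets of the edge ideal of `G` is the edge ideal of the graph obtained by
replacing each vertex of `G` by `s + 1` independent copies. -/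
theorem principalJetIdeal_edgeIdeal [Finite V] (s : ℕ) (G : SimpleGraph V) :
    principalJetIdeal s (edgeIdeal k G) =
      edgeIdeal k (G.comap (Prod.fst : JetVars s V → V)) := by
  refine le_antisymm (fun f hf => ?_) (edgeIdeal_comap_fst_le s G)
  rw [mem_edgeIdeal_iff]
  intro m hm
  by_contra! h
  have hind : G.IsIndepSet (Prod.fst '' {u | m u ≠ 0}) := by
    rintro _ ⟨u, hu, rfl⟩ _ ⟨v, hv, rfl⟩ - huv
    exact hv (h u v huv hu)
  -- The prime of the component of `M` contains `f`, so `m` must involve a variable lying outside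
  -- `M`, a contradiction.
  obtain ⟨M, hsM, hM, hmax⟩ := exists_maximal_isIndepSet G hind
  obtain ⟨u, hu, hmu⟩ := mem_ideal_span_X_image.mp
    (principalJetIdeal_le_span_X_image s hM hmax hf) m hm
  exact hu (hsM ⟨u, hmu, rfl⟩)

theorem principalJetGraph_eq [Finite V] (s : ℕ) (G : SimpleGraph V) :
    principalJetGraph k s G = G.comap (Prod.fst : JetVars s V → V) := by
  ext u v
  change u ≠ v ∧ _ ↔ _
  rw [principalJetIdeal_edgeIdeal]
  constructor
  · rintro ⟨huv, h⟩
    exact (X_mul_X_mem_edgeIdeal_iff huv).mp h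
  · intro h
    exact ⟨h.ne, (X_mul_X_mem_edgeIdeal_iff h.ne).mpr h⟩

end Principal

end PrincipalJets

theorem mainTheorem12 (k : Type*) [Field k] {X : Type*} [Finite X] (G : SimpleGraph X) :
    (∀ (s : ℕ) (H : SimpleGraph (PrincipalJets.JetVars s X)),
      PrincipalJets.edgeIdeal k H =
          PrincipalJets.principalJetIdeal s (PrincipalJets.edgeIdeal k G) ↔
        H = PrincipalJets.principalJetGraph k s G) ∧
    (PrincipalJets.IsCochordal G ↔
      ∀ s : ℕ, PrincipalJets.IsCochordal (PrincipalJets.principalJetGraph k s G)) := by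
  refine ⟨fun s H => ?_, fun hG s => ?_, fun h => ?_⟩
  · rw [PrincipalJets.principalJetIdeal_edgeIdeal, PrincipalJets.principalJetGraph_eq,
      PrincipalJets.edgeIdeal_injective.eq_iff]
  · rw [PrincipalJets.principalJetGraph_eq]
    exact PrincipalJets.isCochordal_comap_fst hG
  · have h0 := h 0
    rw [PrincipalJets.principalJetGraph_eq] at h0
    -- For `s = 0` each vertex has a single copy, so the projection is a bijection.
    refine PrincipalJets.isCochordal_of_comap ⟨fun u v huv => ?_, fun x => ⟨(x, 0), rfl⟩⟩ h0
    exact Prod.ext huv (Subsingleton.elim (α := Fin 1) _ _)
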